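/- Let $G=(V,E)$ be a finite, undirected, connected graph without loops or multiple edges, with $n=|V|\ge 2$ vertices. Write $d_x$ for the degree of $x\in V$, $d_{\min}=\min_{x\in V} d_x$ for the minimum degree and $d_{\mathrm{avg}}=\frac1n\sum_{x\in V}d_x$ for the average degree. Lazy random walk on $G$ is the discrete-time Markov chain $(X_t)_{t\ge 0}$ on $V$ with transition matrix $P(x,x)=\frac12$, $P(x,y)=\frac1{2d_x}$ if $xy\in E$, and $P(x,y)=0$ otherwise. Let $\tau_x=\inf\{t\ge 0: X_t=x\}$ and let $t_{\mathrm{hit}}=\max_{y,x\in V}\mathbb{E}_y[\tau_x]$, where $\mathbb{E}_y$ is the expectation for the walk started from $X_0=y$. The eigenvalues of $P$, counted with multiplicity, are real, $1=\lambda_1>\lambda_2\ge\dots\ge\lambda_n$; let $t_{\mathrm{rel}}=(1-\lambda_2)^{-1}$ be the relaxation time. Then \[ t_{\mathrm{hit}}\;\le\;\frac{20\,d_{\mathrm{avg}}}{d_{\min}}\;n\,\sqrt{t_{\mathrm{rel}}+1}. \] -/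

import Mathlib

open MeasureTheory ProbabilityTheory
open scoped ENNReal

namespace LazyWalk

noncomputable section

variable {V : Type*} [Fintype V] [DecidableEq V] (G : SimpleGraph V) [DecidableRel G.Adj]

/-- The transition matrix of lazy random walk on `G`. -/
def transition : Matrix V V ℝ := fun x y =>
  if y = x then 1 / 2 else if G.Adj x y then 1 / (2 * (G.degree x : ℝ)) else 0

/-- The average degree of `G`. -/
def avgDegree : ℝ := (∑ x, (G.degree x : ℝ)) / (Fintype.card V : ℝ)

/-- The second largest eigenvalue of the transition matrix: the real roots of the characteristic
polynomial are listed with multiplicity in decreasing order `λ₁ ≥ λ₂ ≥ ⋯`, and the entry `λ₂`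
(position `1`, counting from `0`) is taken. The default value is never used for a connected graph
with at least two vertices, as all `|V|` eigenvalues are then real. -/
def secondEigenvalue : ℝ :=
  ((transition G).charpoly.roots.sort (fun a b : ℝ => a ≥ b)).getD 1 0

/-- The relaxation time `(1 - λ₂)⁻¹` of lazy random walk. -/
def relaxationTime : ℝ := (1 - secondEigenvalue G)⁻¹

theorem transition_nonneg (x y : V) : 0 ≤ transition G x y := by
  unfold transition
  split_ifs <;> positivity

variable {G}

theorem sum_transition [Nontrivial V] (hG : G.Connected) (x : V) :
    ∑ y, transition G x y = 1 := by
  have hd : (0 : ℝ) < G.degree x := by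
    exact_mod_cast hG.preconnected.degree_pos_of_nontrivial x
  have h : ∀ y, transition G x y =
      (if y = x then (1 / 2 : ℝ) else 0) +
        (if G.Adj x y then 1 / (2 * (G.degree x : ℝ)) else 0) := by
    intro y
    unfold transition
    by_cases hy : y = x
    · subst hy
      simp
    · simp [hy]
  have hc : ((Finset.univ.filter fun y => G.Adj x y).card : ℝ) = G.degree x := by
    rw [← SimpleGraph.card_neighborFinset_eq_degree, SimpleGraph.neighborFinset_eq_filter]
  simp_rw [h]
  rw [Finset.sum_add_distrib, Finset.sum_ite_eq', ← Finset.sum_filter, Finset.sum_const,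
    nsmul_eq_mul, hc]
  simp only [Finset.mem_univ, if_true]
  field_simp
  norm_num

/-- The law of one step of lazy random walk from `x`: the row `P(x, ·)`. -/
def stepPMF [Nontrivial V] (hG : G.Connected) (x : V) : PMF V :=
  PMF.ofFintype (fun y => ENNReal.ofReal (transition G x y)) (by
    rw [← ENNReal.ofReal_sum_of_nonneg (fun y _ => transition_nonneg G x y),
      sum_transition hG x, ENNReal.ofReal_one])

variable [MeasurableSpace V] [DiscreteMeasurableSpace V]

/-- The Markov kernel on `V` of lazy random walk. -/
def stepKernel [Nontrivial V] (hG : G.Connected) : Kernel V V :=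
  Kernel.ofFunOfCountable fun x => (stepPMF hG x).toMeasure

instance stepKernel_isMarkovKernel [Nontrivial V] (hG : G.Connected) : IsMarkovKernel (stepKernel hG) :=
  ⟨fun x => inferInstanceAs (IsProbabilityMeasure (stepPMF hG x).toMeasure)⟩

/-- The law on the trajectory space `ℕ → V` of lazy random walk started from `y`: `X₀ = y`, and
given `X₀, …, Xₙ` the next position `Xₙ₊₁` has law `P(Xₙ, ·)`. The walk itself is the coordinate
process. -/
def walkMeasure [Nontrivial V] (hG : G.Connected) (y : V) : Measure (ℕ → V) :=
  Kernel.trajMeasure (X := fun _ => V) (Measure.dirac y) fun n =>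
    (stepKernel hG).comap (fun h : (Finset.Iic n → V) => h ⟨n, Finset.mem_Iic.2 le_rfl⟩)
      (measurable_pi_apply _)

/-- The hitting time `inf {t ≥ 0 : X_t = x}` of `x` along a trajectory (`∞` if never hit). -/
def hittingTime {V : Type*} (x : V) (ω : ℕ → V) : ℕ∞ :=
  hittingAfter (fun (t : ℕ) (ω : ℕ → V) => ω t) {x} 0 ω

/-- The expected hitting time of `x` from `y`, as an extended nonnegative real. -/
def expectedHittingTime [Nontrivial V] (hG : G.Connected) (y x : V) : ℝ≥0∞ :=
  ∫⁻ ω, (hittingTime x ω : ℝ≥0∞) ∂(walkMeasure hG y)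

/-- The maximum expected hitting time (a supremum over finitely many pairs). -/
def maxHittingTime [Nontrivial V] (hG : G.Connected) : ℝ≥0∞ :=
  ⨆ (y : V) (x : V), expectedHittingTime hG y x

end

end LazyWalk

/-! View `G` as a network of unit resistors. The expected hitting times of `x` solve a Poisson
equation with value `0` at `x`. Pairing its solution `H` with the Laplacian gives `energy G H = 2 *
∑ d_v H v`, hence at most `2 vol(G) max H`. If the squared oscillation of every function is at most
`R` times its energy (a bound on effective resistance), then `(max H)² ≤ 2 R vol(G) max H`, so `max
H ≤ 2 R vol(G)`. The theorem follows with `R = 10 √(t_rel + 1) / d_min`.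

The value of `R` comes from playing two inequalities against each other. The Nash-type inequality
`sub_pow_four_le_energy_mul_sum_sq` bounds `d_min · osc⁴` by energy times the sum of squares; the
Poincaré inequality `spectralGap_mul_sum_le_energy` bounds the sum of squares of a centred function
by `t_rel` times energy. Together they give `osc⁴ ≲ t_rel · energy² / d_min²`, whose square root is
the source of `√t_rel`.

The Nash inequality rests on `card_superlevel_mul_energy_ge`: a peak above level `s` costs energy
inversely proportional to the size of the superlevel set. Either the peak has many edges leaving a
small set, or it is far from the complement, and then minimum degree makes the set large.

`expectedHittingTime_le` returns to the walk: a nonnegative solution of the Poisson equation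
dominates the expected hitting time by telescoping, with no prior finiteness needed. -/

namespace LazyWalk

open Finset

/-! ### Dirichlet energy and Nash-type inequalities from the minimum degree. -/

section Energy

variable {V : Type*} [Fintype V] [DecidableEq V] (G : SimpleGraph V) [DecidableRel G.Adj]

/-- The Dirichlet energy of `g`, the sum over the edges of the squared increments. -/
noncomputable def energy (g : V → ℝ) : ℝ :=
  (∑ u, ∑ v, if G.Adj u v then (g u - g v) ^ 2 else 0) / 2

omit [DecidableEq V] in
theorem energy_nonneg (g : V → ℝ) : 0 ≤ energy G g := by
  unfold energy
  refine div_nonneg (sum_nonneg fun u _ => sum_nonneg fun v _ => ?_) zero_le_two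
  split_ifs <;> positivity

variable {G}

/-- A set of edges oriented by a height function contributes at most the energy. -/
theorem sum_sq_le_energy {ι : Type*} (g : V → ℝ) (r : V → ℕ) (s : Finset ι) (a b : ι → V)
    (hadj : ∀ i ∈ s, G.Adj (a i) (b i)) (hr : ∀ i ∈ s, r (a i) < r (b i))
    (hinj : Set.InjOn (fun i => (a i, b i)) s) :
    ∑ i ∈ s, (g (a i) - g (b i)) ^ 2 ≤ energy G g := by
  classical
  -- `F` sees an edge in its uphill direction only, so `F (u, v) + F (v, u)` is at most one
  -- ordered-pair term; doubling `∑ F` absorbs the `/ 2` in `energy`.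
  let F : V × V → ℝ := fun p => if G.Adj p.1 p.2 ∧ r p.1 < r p.2 then (g p.1 - g p.2) ^ 2 else 0
  have hF : ∀ p, 0 ≤ F p := fun p => by
    dsimp only [F]; split_ifs <;> positivity
  have h1 : ∑ i ∈ s, (g (a i) - g (b i)) ^ 2 ≤ ∑ p, F p := by
    calc ∑ i ∈ s, (g (a i) - g (b i)) ^ 2 = ∑ i ∈ s, F (a i, b i) := by
          refine sum_congr rfl fun i hi => ?_
          simp [F, hadj i hi, hr i hi]
      _ = ∑ p ∈ s.image (fun i => (a i, b i)), F p := (sum_image hinj).symm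
      _ ≤ ∑ p, F p := sum_le_univ_sum_of_nonneg hF
  have h2 : ∑ p, F p = ∑ u, ∑ v, F (u, v) := Fintype.sum_prod_type _
  have h3 : ∑ p, F p = ∑ u, ∑ v, F (v, u) := by rw [h2, sum_comm]
  have h4 : ∑ p, F p + ∑ p, F p ≤ ∑ u, ∑ v, if G.Adj u v then (g u - g v) ^ 2 else 0 := by
    nth_rewrite 1 [h2]
    rw [h3, ← sum_add_distrib]
    refine sum_le_sum fun u _ => ?_
    rw [← sum_add_distrib]
    refine sum_le_sum fun v _ => ?_
    by_cases h : G.Adj u v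
    · have h' := h.symm
      simp only [F, h, h', true_and, if_true]
      rcases lt_trichotomy (r u) (r v) with h0 | h0 | h0
      · simp [h0, h0.not_gt]
      · simp only [h0, lt_irrefl, if_false, add_zero]; positivity
      · simp only [h0, h0.not_gt, if_true, if_false, zero_add]
        exact le_of_eq (by ring)
    · have h' : ¬ G.Adj v u := fun h0 => h h0.symm
      simp [F, h, h']
  unfold energy
  linarith

omit [Fintype V] [DecidableEq V] [DecidableRel G.Adj] in
/-- A walk realising the distance moves away from its starting point at unit speed. -/
theorem dist_getVert_of_length_eq_dist {x w : V} (p : G.Walk x w) (hp : p.length = G.dist x w)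
    {i : ℕ} (hi : i ≤ p.length) : G.dist x (p.getVert i) = i := by
  have h1 : G.dist x (p.getVert i) ≤ i := by
    have := SimpleGraph.dist_le (p.take i)
    rwa [SimpleGraph.Walk.take_length, min_eq_left hi] at this
  have h2 : G.dist (p.getVert i) w ≤ p.length - i := by
    have := SimpleGraph.dist_le (p.drop i)
    rwa [SimpleGraph.Walk.drop_length] at this
  have h3 : G.dist x w ≤ G.dist x (p.getVert i) + G.dist (p.getVert i) w := by
    by_contra! h
    obtain ⟨q1, hq1⟩ := (SimpleGraph.Walk.reachable (p.take i)).exists_walk_length_eq_dist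
    obtain ⟨q2, hq2⟩ := (SimpleGraph.Walk.reachable (p.drop i)).exists_walk_length_eq_dist
    have := SimpleGraph.dist_le (q1.append q2)
    rw [SimpleGraph.Walk.length_append] at this
    omega
  omega

/-- Along a shortest path the squared increment is at most the distance times the energy. -/
theorem sub_sq_le_dist_mul_energy (hG : G.Connected) (g : V → ℝ) (x w : V) :
    (g x - g w) ^ 2 ≤ G.dist x w * energy G g := by
  obtain ⟨p, hp⟩ := hG.exists_walk_length_eq_dist x w
  have hd := fun i hi => dist_getVert_of_length_eq_dist p hp (i := i) hi
  have hsum : g x - g w = ∑ i ∈ range p.length, (g (p.getVert i) - g (p.getVert (i + 1))) := by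
    rw [sum_range_sub']
    simp
  have hE : ∑ i ∈ range p.length, (g (p.getVert i) - g (p.getVert (i + 1))) ^ 2 ≤ energy G g := by
    refine sum_sq_le_energy g (G.dist x) _ _ _ ?_ ?_ ?_
    · intro i hi
      exact p.adj_getVert_succ (mem_range.1 hi)
    · intro i hi
      have hi := mem_range.1 hi
      rw [hd i hi.le, hd (i + 1) hi]
      omega
    · intro i hi j hj hij
      have hi := mem_range.1 (mem_coe.1 hi)
      have hj := mem_range.1 (mem_coe.1 hj)
      have := congrArg (G.dist x) (Prod.ext_iff.1 hij).1
      simpa [hd i hi.le, hd j hj.le] using this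
  calc (g x - g w) ^ 2 ≤ (range p.length).card *
        ∑ i ∈ range p.length, (g (p.getVert i) - g (p.getVert (i + 1))) ^ 2 := by
        rw [hsum]; exact sq_sum_le_card_mul_sum_sq
    _ ≤ G.dist x w * energy G g := by
        rw [card_range, ← hp]
        exact mul_le_mul_of_nonneg_left hE (Nat.cast_nonneg _)

/-- A set containing the ball of radius `L - 1` about `x`, when some vertex is at distance `L`,
has at least `(δ + 1) ⌊(L + 1) / 3⌋` vertices, `δ` the minimum degree. -/
theorem mul_minDegree_succ_le_card (hG : G.Connected) {x w : V} (A : Finset V)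
    (hA : ∀ v, G.dist x v < G.dist x w → v ∈ A) :
    (G.dist x w + 1) / 3 * (G.minDegree + 1) ≤ A.card := by
  obtain ⟨p, hp⟩ := hG.exists_walk_length_eq_dist x w
  have hd := fun i hi => dist_getVert_of_length_eq_dist p hp (i := i) hi
  set J := (G.dist x w + 1) / 3 with hJ
  -- Unit balls around every third vertex of a geodesic are disjoint. The choice of `J` gives `3 *
  -- (J - 1) + 1 < G.dist x w`, which keeps them all inside `A`.
  let B : ℕ → Finset V := fun j => insert (p.getVert (3 * j)) (G.neighborFinset (p.getVert (3 * j)))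
  have hB : ∀ j < J, ∀ v ∈ B j, G.dist x v ≤ 3 * j + 1 ∧ 3 * j ≤ G.dist x v + 1 := by
    intro j hj v hv
    have h0 := hd (3 * j) (by omega)
    rcases mem_insert.1 hv with rfl | hv
    · omega
    · have hadj : G.Adj (p.getVert (3 * j)) v := by simpa using hv
      have h1 := hG.dist_triangle (u := x) (v := p.getVert (3 * j)) (w := v)
      have h2 := hG.dist_triangle (u := x) (v := v) (w := p.getVert (3 * j))
      rw [SimpleGraph.dist_eq_one_iff_adj.2 hadj] at h1
      rw [SimpleGraph.dist_eq_one_iff_adj.2 hadj.symm] at h2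
      omega
  have hcard : ∀ j, G.minDegree + 1 ≤ (B j).card := by
    intro j
    rw [card_insert_of_notMem (by simp), SimpleGraph.card_neighborFinset_eq_degree]
    exact Nat.succ_le_succ (G.minDegree_le_degree _)
  have hdisj : ∀ i ∈ range J, ∀ j ∈ range J, i ≠ j → Disjoint (B i) (B j) := by
    intro i hi j hj hij
    rw [Finset.disjoint_left]
    intro v hvi hvj
    have h1 := hB i (mem_range.1 hi) v hvi
    have h2 := hB j (mem_range.1 hj) v hvj
    omega
  calc J * (G.minDegree + 1) = ∑ _j ∈ range J, (G.minDegree + 1) := by simp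
    _ ≤ ∑ j ∈ range J, (B j).card := sum_le_sum fun j _ => hcard j
    _ = ((range J).biUnion B).card := (card_biUnion hdisj).symm
    _ ≤ A.card := by
      refine card_le_card fun v hv => ?_
      obtain ⟨j, hj, hv⟩ := mem_biUnion.1 hv
      have hj := mem_range.1 hj
      have := hB j hj v hv
      exact hA v (by omega)

/-- Isoperimetric bound for the superlevel sets of a function. -/
theorem card_superlevel_mul_energy_ge (hG : G.Connected) (g : V → ℝ) {s : ℝ} {x z : V}
    (hx : s < g x) (hz : g z ≤ s) :
    (G.minDegree : ℝ) / 4 * (g x - s) ^ 2 ≤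
      ((univ.filter fun v => s < g v).card : ℝ) * energy G g := by
  set A := univ.filter fun v => s < g v with hAdef
  have hE := energy_nonneg G g
  by_cases hnb : ∃ v, G.Adj x v ∧ g v ≤ s
  · set K := (G.neighborFinset x).filter fun v => g v ≤ s with hK
    have hk1 : 1 ≤ K.card := by
      obtain ⟨v, hv, hvs⟩ := hnb
      exact card_pos.2 ⟨v, by simp [hK, hv, hvs]⟩
    have hk2 : K.card ≤ G.degree x := by
      rw [← SimpleGraph.card_neighborFinset_eq_degree]
      exact card_filter_le _ _
    have hN : G.degree x + 1 ≤ A.card + K.card := by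
      have hsub : insert x (G.neighborFinset x) ⊆ A ∪ K := by
        intro v hv
        rcases mem_insert.1 hv with rfl | hv
        · simp [hAdef, hx]
        · by_cases h : g v ≤ s
          · exact mem_union_right _ (mem_filter.2 ⟨hv, h⟩)
          · exact mem_union_left _ (by simpa [hAdef] using h)
      have := (card_le_card hsub).trans (card_union_le _ _)
      rwa [card_insert_of_notMem (by simp), SimpleGraph.card_neighborFinset_eq_degree] at this
    have hKE : (K.card : ℝ) * (g x - s) ^ 2 ≤ energy G g := by
      have h1 : ∑ v ∈ K, (g x - g v) ^ 2 ≤ energy G g := by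
        refine sum_sq_le_energy g (G.dist x) K (fun _ => x) id ?_ ?_ ?_
        · intro v hv
          simpa using (mem_filter.1 hv).1
        · intro v hv
          have : G.Adj x v := by simpa using (mem_filter.1 hv).1
          simp [SimpleGraph.dist_eq_one_iff_adj.2 this]
        · intro u _ v _ huv
          exact (Prod.ext_iff.1 huv).2
      refine le_trans ?_ h1
      rw [← nsmul_eq_mul]
      refine card_nsmul_le_sum _ _ _ fun v hv => ?_
      have := (mem_filter.1 hv).2
      exact pow_le_pow_left₀ (by linarith) (by linarith) 2
    have hδ : (G.minDegree : ℝ) ≤ G.degree x := by exact_mod_cast G.minDegree_le_degree x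
    have hk1' : (1 : ℝ) ≤ K.card := by exact_mod_cast hk1
    have hk2' : (K.card : ℝ) ≤ G.degree x := by exact_mod_cast hk2
    have hN' : (G.degree x : ℝ) + 1 ≤ A.card + K.card := by exact_mod_cast hN
    -- With `d` the degree of `x` and `k = K.card`: `(d + 1 - k) k - d = (k - 1)(d - k) ≥ 0`.
    have hNk : (G.minDegree : ℝ) ≤ A.card * K.card := by
      nlinarith [mul_nonneg (sub_nonneg.2 hk1') (sub_nonneg.2 hk2')]
    calc (G.minDegree : ℝ) / 4 * (g x - s) ^ 2 ≤ A.card * K.card * (g x - s) ^ 2 := by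
          gcongr
          have : (0 : ℝ) ≤ G.minDegree := Nat.cast_nonneg _
          linarith
      _ = A.card * (K.card * (g x - s) ^ 2) := by ring
      _ ≤ A.card * energy G g := by gcongr
  · push Not at hnb
    obtain ⟨w, hw, hmin⟩ := exists_min_image (univ.filter fun v => g v ≤ s) (G.dist x)
      ⟨z, by simp [hz]⟩
    have hws : g w ≤ s := (mem_filter.1 hw).2
    have hxw : x ≠ w := fun h => by rw [h] at hx; exact hx.not_ge hws
    have hL : 2 ≤ G.dist x w := by
      have h0 : G.dist x w ≠ 0 := (hG.pos_dist_of_ne hxw).ne'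
      have h1 : G.dist x w ≠ 1 := fun h =>
        (hnb w (SimpleGraph.dist_eq_one_iff_adj.1 h)).not_ge hws
      omega
    have hcard := mul_minDegree_succ_le_card hG (x := x) (w := w) A fun v hv => by
      by_contra h
      have h' : g v ≤ s := by simpa [hAdef] using h
      exact (hmin v (by simp [h'])).not_gt hv
    have hLA : G.dist x w * G.minDegree ≤ 4 * A.card := by
      -- This needs distance at least `2` and is sharp at `4`; it is the source of the `4` in the
      -- statement.
      have : G.dist x w ≤ 4 * ((G.dist x w + 1) / 3) := by omega
      calc G.dist x w * G.minDegree ≤ 4 * ((G.dist x w + 1) / 3) * (G.minDegree + 1) :=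
            Nat.mul_le_mul this (Nat.le_succ _)
        _ ≤ 4 * A.card := by rw [mul_assoc]; exact Nat.mul_le_mul_left _ hcard
    have hLA' : (G.dist x w : ℝ) * G.minDegree ≤ 4 * A.card := by exact_mod_cast hLA
    have hpath := sub_sq_le_dist_mul_energy hG g x w
    have hsq : (g x - s) ^ 2 ≤ G.dist x w * energy G g :=
      (pow_le_pow_left₀ (by linarith) (by linarith) 2).trans hpath
    calc (G.minDegree : ℝ) / 4 * (g x - s) ^ 2
        ≤ (G.minDegree : ℝ) / 4 * (G.dist x w * energy G g) := by gcongr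
      _ = (G.dist x w * G.minDegree) / 4 * energy G g := by ring
      _ ≤ A.card * energy G g := by gcongr; linarith

/-- Nash-type inequality for a nonnegative function vanishing at some vertex. -/
theorem pow_four_le_energy_mul_sum_sq (hG : G.Connected) (g : V → ℝ) (hg : ∀ v, 0 ≤ g v)
    {x z : V} (hz : g z = 0) :
    (G.minDegree : ℝ) / 50 * g x ^ 4 ≤ energy G g * ∑ v, g v ^ 2 := by
  have hE := energy_nonneg G g
  rcases (hg x).eq_or_lt with h0 | h0
  · rw [← h0]
    simp only [ne_eq, OfNat.ofNat_ne_zero, not_false_eq_true, zero_pow, mul_zero]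
    exact mul_nonneg hE (sum_nonneg fun v _ => sq_nonneg _)
  set α := g x with hα
  have ha := card_superlevel_mul_energy_ge hG g (s := 2 / 5 * α) (x := x) (z := z)
    (by linarith) (by linarith)
  have hb := card_superlevel_mul_energy_ge hG g (s := 3 / 5 * α) (x := x) (z := z)
    (by linarith) (by linarith)
  set Na := ((univ.filter fun v => 2 / 5 * α < g v).card : ℝ) with hNa
  set Nb := ((univ.filter fun v => 3 / 5 * α < g v).card : ℝ) with hNb
  -- A two-level layer-cake bound: `5/25 = (3/5)² - (2/5)²`. The resulting constant is `56/2500 ≥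
  -- 1/50`, whereas a single level gives at most `1/64`.
  have hsum : 4 / 25 * α ^ 2 * Na + 5 / 25 * α ^ 2 * Nb ≤ ∑ v, g v ^ 2 := by
    rw [hNa, hNb, card_filter, card_filter]
    push_cast
    rw [mul_sum, mul_sum, ← sum_add_distrib]
    refine sum_le_sum fun v _ => ?_
    have := hg v
    split_ifs with h1 h2 h2 <;> nlinarith
  calc (G.minDegree : ℝ) / 50 * α ^ 4
      ≤ 4 / 25 * α ^ 2 * ((G.minDegree : ℝ) / 4 * (α - 2 / 5 * α) ^ 2) +
        5 / 25 * α ^ 2 * ((G.minDegree : ℝ) / 4 * (α - 3 / 5 * α) ^ 2) := by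
        have : 0 ≤ (G.minDegree : ℝ) * α ^ 4 := by positivity
        nlinarith
    _ ≤ 4 / 25 * α ^ 2 * (Na * energy G g) + 5 / 25 * α ^ 2 * (Nb * energy G g) := by
        rw [← hα] at ha hb
        gcongr
    _ = energy G g * (4 / 25 * α ^ 2 * Na + 5 / 25 * α ^ 2 * Nb) := by ring
    _ ≤ energy G g * ∑ v, g v ^ 2 := by gcongr

omit [DecidableEq V] in
-- Along an edge the increments of the positive and negative parts have opposite signs, so the cross
-- term in the square of their difference is nonnegative.
theorem energy_posPart_add_negPart_le (f : V → ℝ) :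
    energy G (fun v => max (f v) 0) + energy G (fun v => max (-f v) 0) ≤ energy G f := by
  unfold energy
  rw [← add_div]
  refine div_le_div_of_nonneg_right ?_ zero_le_two
  rw [← sum_add_distrib]
  refine sum_le_sum fun u _ => ?_
  rw [← sum_add_distrib]
  refine sum_le_sum fun v _ => ?_
  split_ifs
  · rcases le_total (f u) 0 with hu | hu <;> rcases le_total (f v) 0 with hv | hv <;>
      simp [hu, hv] <;> nlinarith
  · simp

/-- Nash-type inequality for the increment of a function that changes sign. -/
theorem sub_pow_four_le_energy_mul_sum_sq (hG : G.Connected) (f : V → ℝ) {x y : V}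
    (hx : 0 ≤ f x) (hy : f y ≤ 0) :
    (G.minDegree : ℝ) / 200 * (f x - f y) ^ 4 ≤ energy G f * ∑ v, f v ^ 2 := by
  have h1 := pow_four_le_energy_mul_sum_sq hG (fun v => max (f v) 0) (fun v => le_max_right _ _)
    (x := x) (z := y) (max_eq_right hy)
  have h2 := pow_four_le_energy_mul_sum_sq hG (fun v => max (-f v) 0) (fun v => le_max_right _ _)
    (x := y) (z := x) (max_eq_right (by linarith))
  have hE := energy_posPart_add_negPart_le (G := G) f
  have hS : ∑ v, f v ^ 2 = ∑ v, max (f v) 0 ^ 2 + ∑ v, max (-f v) 0 ^ 2 := by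
    rw [← sum_add_distrib]
    refine sum_congr rfl fun v _ => ?_
    rcases le_total (f v) 0 with h | h <;> simp [h]
  have hE1 := energy_nonneg G (fun v => max (f v) 0)
  have hE2 := energy_nonneg G (fun v => max (-f v) 0)
  have hS1 : 0 ≤ ∑ v, max (f v) 0 ^ 2 := sum_nonneg fun v _ => sq_nonneg _
  have hS2 : 0 ≤ ∑ v, max (-f v) 0 ^ 2 := sum_nonneg fun v _ => sq_nonneg _
  simp only [max_eq_left hx, max_eq_left (neg_nonneg.2 hy)] at h1 h2
  rw [hS]
  generalize energy G (fun v => max (f v) 0) = E1 at *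
  generalize energy G (fun v => max (-f v) 0) = E2 at *
  generalize ∑ v, max (f v) 0 ^ 2 = S1 at *
  generalize ∑ v, max (-f v) 0 ^ 2 = S2 at *
  have hδ : (0 : ℝ) ≤ G.minDegree / 50 := by positivity
  set δ : ℝ := G.minDegree / 50
  set a := f x
  set b := -f y with hb
  have hb0 : 0 ≤ b := by linarith
  -- Multiplying the two one-sided inequalities and applying AM-GM supplies the cross term that
  -- completes `δ (a² + b²)²`.
  have hcross : 2 * (δ * a ^ 2 * b ^ 2) ≤ E1 * S2 + E2 * S1 := by
    have hprod : (δ * a ^ 2 * b ^ 2) ^ 2 ≤ (E1 * S2) * (E2 * S1) := by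
      calc (δ * a ^ 2 * b ^ 2) ^ 2 = (δ * a ^ 4) * (δ * b ^ 4) := by ring
        _ ≤ (E1 * S1) * (E2 * S2) := by gcongr
        _ = (E1 * S2) * (E2 * S1) := by ring
    have h0 : 0 ≤ E1 * S2 + E2 * S1 := by positivity
    refine abs_le_of_sq_le_sq' ?_ h0 |>.2
    nlinarith [sq_nonneg (E1 * S2 - E2 * S1)]
  have hquad : (a + b) ^ 4 ≤ 4 * (a ^ 2 + b ^ 2) ^ 2 := by
    have h : (a + b) ^ 2 ≤ 2 * (a ^ 2 + b ^ 2) := by nlinarith [sq_nonneg (a - b)]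
    calc (a + b) ^ 4 = ((a + b) ^ 2) ^ 2 := by ring
      _ ≤ (2 * (a ^ 2 + b ^ 2)) ^ 2 := by gcongr
      _ = 4 * (a ^ 2 + b ^ 2) ^ 2 := by ring
  calc (G.minDegree : ℝ) / 200 * (a - f y) ^ 4 = δ / 4 * (a + b) ^ 4 := by
        simp only [δ, hb]; ring
    _ ≤ δ / 4 * (4 * (a ^ 2 + b ^ 2) ^ 2) := by gcongr
    _ = δ * a ^ 4 + 2 * (δ * a ^ 2 * b ^ 2) + δ * b ^ 4 := by ring
    _ ≤ E1 * S1 + (E1 * S2 + E2 * S1) + E2 * S2 := by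
        have hbb : (-f y) ^ 4 = b ^ 4 := rfl
        gcongr
    _ = (E1 + E2) * (S1 + S2) := by ring
    _ ≤ energy G f * (S1 + S2) := by gcongr

end Energy


/-! ### Spectral gap, resistance bound and the Poisson equation. -/

section Spectral

open Matrix

variable {V : Type*} [Fintype V] [DecidableEq V] {G : SimpleGraph V} [DecidableRel G.Adj]

theorem energy_eq_dotProduct (f : V → ℝ) : energy G f = f ⬝ᵥ (G.lapMatrix ℝ *ᵥ f) := by
  rw [energy, ← SimpleGraph.lapMatrix_toLinearMap₂' ℝ G f, Matrix.toLinearMap₂'_apply']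

omit [DecidableEq V] in
theorem degree_pos_real [Nontrivial V] (hG : G.Connected) (x : V) : (0 : ℝ) < G.degree x := by
  exact_mod_cast hG.preconnected.degree_pos_of_nontrivial x

theorem degree_mul_transition [Nontrivial V] (hG : G.Connected) (x y : V) :
    (G.degree x : ℝ) * transition G x y =
      ((if y = x then (G.degree x : ℝ) else 0) + (if G.Adj x y then 1 else 0)) / 2 := by
  have hd := degree_pos_real hG x
  unfold transition
  split_ifs with h1 h2 h2
  · subst h1; exact absurd h2 G.irrefl
  · ring
  · field_simp; ring
  · ring

/-- The generator of the lazy walk is half the normalised Laplacian. -/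
theorem degree_mul_sub_transition_mulVec [Nontrivial V] (hG : G.Connected) (f : V → ℝ) (x : V) :
    (G.degree x : ℝ) * (f x - (transition G *ᵥ f) x) = (G.lapMatrix ℝ *ᵥ f) x / 2 := by
  rw [SimpleGraph.lapMatrix_mulVec_apply, mul_sub, mulVec, dotProduct, mul_sum]
  have : ∀ y, (G.degree x : ℝ) * (transition G x y * f y) =
      ((if y = x then (G.degree x : ℝ) * f y else 0) + (if G.Adj x y then f y else 0)) / 2 := by
    intro y
    rw [← mul_assoc, degree_mul_transition hG]
    split_ifs <;> ring
  simp_rw [this]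
  rw [← sum_div, sum_add_distrib, sum_ite_eq', if_pos (mem_univ x), ← sum_filter,
    SimpleGraph.neighborFinset_eq_filter]
  ring

/-- The Dirichlet form of `I - P` in the degree weights; laziness causes the factor one half. -/
theorem sum_degree_mul_sub_transition [Nontrivial V] (hG : G.Connected) (f : V → ℝ) :
    ∑ x, (G.degree x : ℝ) * f x * (f x - (transition G *ᵥ f) x) = energy G f / 2 := by
  rw [energy_eq_dotProduct, dotProduct, sum_div]
  refine sum_congr rfl fun x _ => ?_
  rw [mul_right_comm, degree_mul_sub_transition_mulVec hG]
  ring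

theorem eq_of_energy_eq_zero (hG : G.Connected) {f : V → ℝ} (hf : energy G f = 0) (u v : V) :
    f u = f v := by
  have h := SimpleGraph.lapMatrix_toLinearMap₂'_apply'_eq_zero_iff_forall_reachable G f
  rw [SimpleGraph.lapMatrix_toLinearMap₂'] at h
  exact h.1 hf u v (hG.preconnected u v)

variable (G) in
/-- The transition matrix symmetrised by the square roots of the degrees. -/
noncomputable def symTransition : Matrix V V ℝ := fun x y =>
  √(G.degree x) * transition G x y * (√(G.degree y))⁻¹

/-- This is reversibility of the walk with respect to the degrees. -/
theorem symTransition_isHermitian [Nontrivial V] (hG : G.Connected) :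
    (symTransition G).IsHermitian := by
  ext x y
  simp only [conjTranspose_apply, symTransition, star_trivial]
  have hx := degree_pos_real hG x
  have hy := degree_pos_real hG y
  have sx := Real.sqrt_pos.2 hx
  have sy := Real.sqrt_pos.2 hy
  have qx := Real.mul_self_sqrt hx.le
  have qy := Real.mul_self_sqrt hy.le
  unfold transition
  by_cases h : y = x
  · subst h; rfl
  · rw [if_neg h, if_neg (Ne.symm h)]
    by_cases ha : G.Adj x y
    · rw [if_pos ha, if_pos ha.symm]
      field_simp
      rw [sq, sq, qx, qy]
    · rw [if_neg ha, if_neg (fun h' => ha h'.symm)]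
      ring

/-- Conjugation by the square roots of the degrees is undone by cyclic invariance of the
characteristic polynomial, so spectral theory for Hermitian matrices applies to `P`. -/
theorem symTransition_charpoly [Nontrivial V] (hG : G.Connected) :
    (symTransition G).charpoly = (transition G).charpoly := by
  have h : symTransition G = diagonal (fun x => √(G.degree x : ℝ)) *
      (transition G * diagonal (fun y => (√(G.degree y : ℝ))⁻¹)) := by
    ext x y
    rw [diagonal_mul, mul_diagonal, symTransition, mul_assoc]
  rw [h, charpoly_mul_comm, mul_assoc, diagonal_mul_diagonal]
  have : (fun i => (√(G.degree i : ℝ))⁻¹ * √(G.degree i : ℝ)) = fun _ => 1 := by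
    ext i
    exact inv_mul_cancel₀ (Real.sqrt_pos.2 (degree_pos_real hG i)).ne'
  rw [this, diagonal_one, mul_one]

theorem symTransition_mulVec [Nontrivial V] (hG : G.Connected) (f : V → ℝ) :
    symTransition G *ᵥ (fun x => √(G.degree x) * f x) =
      fun x => √(G.degree x) * (transition G *ᵥ f) x := by
  ext x
  simp only [mulVec, dotProduct, mul_sum, symTransition]
  refine sum_congr rfl fun y _ => ?_
  have := (Real.sqrt_pos.2 (degree_pos_real hG y)).ne'
  field_simp

theorem secondEigenvalue_eq_eigenvalues₀ [Nontrivial V] (hG : G.Connected) :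
    secondEigenvalue G =
      (symTransition_isHermitian hG).eigenvalues₀ ⟨1, Fintype.one_lt_card⟩ := by
  have h := (symTransition_isHermitian hG).sort_roots_charpoly_eq_eigenvalues₀
  rw [symTransition_charpoly hG] at h
  have hre : ((transition G).charpoly.roots.map (RCLike.re : ℝ → ℝ)) =
      (transition G).charpoly.roots := by simp
  rw [hre] at h
  have hc : 1 < Fintype.card V := Fintype.one_lt_card
  rw [secondEigenvalue, h]
  simp [List.getD, hc]

omit [DecidableEq V] in
/-- Parseval's identity in an orthonormal basis, in terms of dot products. -/
theorem dotProduct_eq_sum_orthonormalBasis (b : OrthonormalBasis V ℝ (EuclideanSpace ℝ V))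
    (f g : V → ℝ) : f ⬝ᵥ g = ∑ i, (⇑(b i) ⬝ᵥ f) * (⇑(b i) ⬝ᵥ g) := by
  have h := b.sum_inner_mul_inner (WithLp.toLp 2 f) (WithLp.toLp 2 g)
  simp only [EuclideanSpace.inner_eq_star_dotProduct, star_trivial] at h
  rw [dotProduct_comm f g, ← h]
  refine sum_congr rfl fun i _ => ?_
  rw [dotProduct_comm g]

theorem dotProduct_orthonormalBasis (b : OrthonormalBasis V ℝ (EuclideanSpace ℝ V)) (i j : V) :
    (⇑(b i) ⬝ᵥ ⇑(b j) : ℝ) = if i = j then 1 else 0 := by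
  have h := orthonormal_iff_ite.1 b.orthonormal i j
  rw [EuclideanSpace.inner_eq_star_dotProduct, star_trivial, dotProduct_comm] at h
  exact h

theorem dotProduct_eigenvectorBasis_mulVec {A : Matrix V V ℝ} (hA : A.IsHermitian) (i : V)
    (g : V → ℝ) : ⇑(hA.eigenvectorBasis i) ⬝ᵥ (A *ᵥ g) =
      hA.eigenvalues i * (⇑(hA.eigenvectorBasis i) ⬝ᵥ g) := by
  have hT : Aᵀ = A := by rw [← conjTranspose_eq_transpose_of_trivial, hA.eq]
  rw [dotProduct_mulVec, ← mulVec_transpose, hT, hA.mulVec_eigenvectorBasis, smul_dotProduct,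
    smul_eq_mul]

/-- Each eigenvalue is `1` minus half the energy of the normalised eigenfunction. -/
theorem eigenvalues_symTransition_eq [Nontrivial V] (hG : G.Connected) (i : V) :
    (symTransition_isHermitian hG).eigenvalues i =
      1 - energy G (fun x => (√(G.degree x))⁻¹ *
        (symTransition_isHermitian hG).eigenvectorBasis i x) / 2 := by
  set hS := symTransition_isHermitian hG
  set f : V → ℝ := fun x => (√(G.degree x))⁻¹ * hS.eigenvectorBasis i x with hf
  have hs : ∀ x, √(G.degree x : ℝ) ≠ 0 := fun x => (Real.sqrt_pos.2 (degree_pos_real hG x)).ne'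
  have hv : ∀ x, hS.eigenvectorBasis i x = √(G.degree x) * f x := fun x => by
    simp only [hf]; field_simp [hs x]
  have hv' : ⇑(hS.eigenvectorBasis i) = fun x => √(G.degree x) * f x := funext hv
  have h1 := dotProduct_orthonormalBasis hS.eigenvectorBasis i i
  rw [if_pos rfl] at h1
  have h2 := dotProduct_eigenvectorBasis_mulVec hS i (hS.eigenvectorBasis i)
  rw [h1, mul_one] at h2
  rw [hv', symTransition_mulVec hG] at h2
  rw [hv'] at h1
  rw [← sum_degree_mul_sub_transition hG, ← h2, ← h1, dotProduct, dotProduct,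
    eq_sub_iff_add_eq, ← sum_add_distrib]
  refine sum_congr rfl fun x _ => ?_
  have := Real.mul_self_sqrt (degree_pos_real hG x).le
  linear_combination (-f x * (f x - (transition G *ᵥ f) x)) * this

/-- The Poincaré inequality: the spectral gap is positive, and it bounds the degree-weighted
variance of a function by its energy. -/
theorem spectralGap_mul_sum_le_energy [Nontrivial V] (hG : G.Connected) :
    secondEigenvalue G < 1 ∧ ∀ f : V → ℝ, ∑ x, (G.degree x : ℝ) * f x = 0 →
      (1 - secondEigenvalue G) * ∑ x, (G.degree x : ℝ) * f x ^ 2 ≤ energy G f / 2 := by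
  set hS := symTransition_isHermitian hG
  set e : Fin (Fintype.card V) ≃ V := Fintype.equivOfCardEq (Fintype.card_fin _) with he
  have hs : ∀ x, √(G.degree x : ℝ) ≠ 0 := fun x => (Real.sqrt_pos.2 (degree_pos_real hG x)).ne'
  have hev : ∀ k, hS.eigenvalues (e k) = hS.eigenvalues₀ k := fun k => by
    simp [Matrix.IsHermitian.eigenvalues, he]
  have hle : ∀ i, hS.eigenvalues i ≤ 1 := fun i => by
    rw [eigenvalues_symTransition_eq hG i]
    have := energy_nonneg G (fun x => (√(G.degree x))⁻¹ * hS.eigenvectorBasis i x)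
    linarith
  have hconst : ∀ i, hS.eigenvalues i = 1 →
      ∃ c : ℝ, c ≠ 0 ∧ ⇑(hS.eigenvectorBasis i) = fun x => √(G.degree x) * c := by
    intro i hi
    rw [eigenvalues_symTransition_eq hG i] at hi
    obtain ⟨z⟩ := hG.nonempty
    have hc := eq_of_energy_eq_zero hG
      (f := fun x => (√(G.degree x))⁻¹ * hS.eigenvectorBasis i x) (by linarith)
    have hfun : ⇑(hS.eigenvectorBasis i) =
        fun x => √(G.degree x) * ((√(G.degree z))⁻¹ * hS.eigenvectorBasis i z) := by
      ext x
      rw [← hc x z, mul_inv_cancel_left₀ (hs x)]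
    refine ⟨_, fun h0 => ?_, hfun⟩
    have h1 := dotProduct_orthonormalBasis hS.eigenvectorBasis i i
    rw [hfun, h0] at h1
    simp [dotProduct] at h1
  have huniq : ∀ i j, hS.eigenvalues i = 1 → hS.eigenvalues j = 1 → i = j := by
    intro i j hi hj
    obtain ⟨c, hc, hci⟩ := hconst i hi
    obtain ⟨c', hc', hcj⟩ := hconst j hj
    by_contra hij
    have h1 := dotProduct_orthonormalBasis hS.eigenvectorBasis i j
    rw [if_neg hij, hci, hcj, dotProduct] at h1
    have h2 : ∑ x, √(G.degree x : ℝ) * c * (√(G.degree x) * c') =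
        (∑ x, (G.degree x : ℝ)) * (c * c') := by
      rw [sum_mul]
      refine sum_congr rfl fun x _ => ?_
      linear_combination (c * c') * Real.mul_self_sqrt (degree_pos_real hG x).le
    have h3 : 0 < ∑ x, (G.degree x : ℝ) :=
      sum_pos (fun x _ => degree_pos_real hG x) (by
        obtain ⟨z⟩ := hG.nonempty
        exact ⟨z, mem_univ z⟩)
    rw [h2] at h1
    exact mul_ne_zero h3.ne' (mul_ne_zero hc hc') h1
  -- The vector of square roots of degrees is fixed. Without an eigenvalue `1` it would be
  -- orthogonal to the whole eigenbasis, hence zero.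
  obtain ⟨i₀, hi₀⟩ : ∃ i, hS.eigenvalues i = 1 := by
    by_contra! hne
    have hone : transition G *ᵥ (fun _ => (1 : ℝ)) = fun _ => 1 := by
      ext x
      simpa [mulVec, dotProduct] using sum_transition hG x
    have hfix := symTransition_mulVec hG (fun _ => 1)
    rw [hone] at hfix
    have hz : ∀ i, ⇑(hS.eigenvectorBasis i) ⬝ᵥ (fun x => √(G.degree x : ℝ) * 1) = 0 := by
      intro i
      have := dotProduct_eigenvectorBasis_mulVec hS i (fun x => √(G.degree x : ℝ) * 1)
      rw [hfix] at this
      have h' : (hS.eigenvalues i - 1) *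
          (⇑(hS.eigenvectorBasis i) ⬝ᵥ (fun x => √(G.degree x : ℝ) * 1)) = 0 := by
        linear_combination -this
      exact (mul_eq_zero.1 h').resolve_left (sub_ne_zero.2 (hne i))
    have h := dotProduct_eq_sum_orthonormalBasis hS.eigenvectorBasis
      (fun x => √(G.degree x : ℝ) * 1) (fun x => √(G.degree x : ℝ) * 1)
    simp only [hz, mul_zero, sum_const_zero] at h
    obtain ⟨z⟩ := hG.nonempty
    have := congrFun (dotProduct_self_eq_zero.1 h) z
    simp only [mul_one, Pi.zero_apply] at this
    exact hs z this
  have hc1 : 1 < Fintype.card V := Fintype.one_lt_card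
  let k0 : Fin (Fintype.card V) := ⟨0, by omega⟩
  let k1 : Fin (Fintype.card V) := ⟨1, hc1⟩
  have htop : hS.eigenvalues (e k0) = 1 := by
    refine le_antisymm (hle _) ?_
    rw [hev, ← hi₀, ← e.apply_symm_apply i₀, hev]
    exact hS.eigenvalues₀_antitone (Fin.mk_le_of_le_val (Nat.zero_le _))
  have hi0 : i₀ = e k0 := huniq _ _ hi₀ htop
  have h2 : secondEigenvalue G = hS.eigenvalues (e k1) := by
    rw [hev]; exact secondEigenvalue_eq_eigenvalues₀ hG
  have hlt : secondEigenvalue G < 1 := by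
    rw [h2]
    refine lt_of_le_of_ne (hle _) fun h => ?_
    have := e.injective (huniq _ _ h htop)
    simp [k0, k1] at this
  have hrest : ∀ i, i ≠ i₀ → hS.eigenvalues i ≤ secondEigenvalue G := by
    intro i hi
    rw [h2, hev, ← e.apply_symm_apply i, hev]
    refine hS.eigenvalues₀_antitone ?_
    have hne : e.symm i ≠ k0 := fun h => hi (by rw [hi0, ← h, e.apply_symm_apply])
    have : (e.symm i : ℕ) ≠ 0 := fun h => hne (Fin.ext h)
    exact Fin.mk_le_of_le_val (by omega)
  refine ⟨hlt, fun f hf => ?_⟩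
  set g : V → ℝ := fun x => √(G.degree x) * f x with hg
  -- Zero degree-weighted mean is exactly orthogonality to the top eigenvector.
  have horth : ⇑(hS.eigenvectorBasis i₀) ⬝ᵥ g = 0 := by
    obtain ⟨c, -, hc⟩ := hconst i₀ hi₀
    rw [hc, dotProduct]
    calc ∑ x, √(G.degree x : ℝ) * c * g x = c * ∑ x, (G.degree x : ℝ) * f x := by
          rw [mul_sum]
          refine sum_congr rfl fun x _ => ?_
          simp only [hg]
          linear_combination (c * f x) * Real.mul_self_sqrt (degree_pos_real hG x).le
      _ = 0 := by rw [hf, mul_zero]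
  have hgg : g ⬝ᵥ g = ∑ x, (G.degree x : ℝ) * f x ^ 2 := by
    refine sum_congr rfl fun x _ => ?_
    simp only [hg]
    linear_combination (f x ^ 2) * Real.mul_self_sqrt (degree_pos_real hG x).le
  have hgS : g ⬝ᵥ g - g ⬝ᵥ (symTransition G *ᵥ g) = energy G f / 2 := by
    rw [← sum_degree_mul_sub_transition hG, hg, symTransition_mulVec hG, dotProduct, dotProduct,
      ← sum_sub_distrib]
    refine sum_congr rfl fun x _ => ?_
    linear_combination (f x * (f x - (transition G *ᵥ f) x)) *
      Real.mul_self_sqrt (degree_pos_real hG x).le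
  have hquad : g ⬝ᵥ (symTransition G *ᵥ g) ≤ secondEigenvalue G * (g ⬝ᵥ g) := by
    rw [dotProduct_eq_sum_orthonormalBasis hS.eigenvectorBasis g (symTransition G *ᵥ g),
      dotProduct_eq_sum_orthonormalBasis hS.eigenvectorBasis g g, mul_sum]
    refine sum_le_sum fun i _ => ?_
    rw [dotProduct_eigenvectorBasis_mulVec hS i g]
    by_cases hi : i = i₀
    · rw [hi, horth]; simp
    · nlinarith [hrest i hi, mul_self_nonneg (⇑(hS.eigenvectorBasis i) ⬝ᵥ g)]
  rw [← hgg, ← hgS]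
  linarith

omit [DecidableEq V] in
theorem energy_sub_const (f : V → ℝ) (c : ℝ) : energy G (fun v => f v - c) = energy G f := by
  simp [energy]

/-- The oscillation of a function is bounded by its energy: a bound on effective resistance. -/
theorem sub_sq_le_sqrt_relaxationTime_mul_energy [Nontrivial V] (hG : G.Connected) (f : V → ℝ)
    {x y : V} (hx : ∀ v, f v ≤ f x) (hy : ∀ v, f y ≤ f v) :
    (f x - f y) ^ 2 ≤ 10 / G.minDegree * √(relaxationTime G + 1) * energy G f := by
  obtain ⟨hgap, hpoin⟩ := spectralGap_mul_sum_le_energy hG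
  have hδ : (0 : ℝ) < G.minDegree := by
    obtain ⟨z, hz⟩ := G.exists_minimal_degree_vertex
    rw [hz]; exact degree_pos_real hG z
  have ht : 0 < relaxationTime G := inv_pos.2 (sub_pos.2 hgap)
  have htgap : relaxationTime G * (1 - secondEigenvalue G) = 1 :=
    inv_mul_cancel₀ (sub_pos.2 hgap).ne'
  set t := relaxationTime G
  have hvol : 0 < ∑ v, (G.degree v : ℝ) :=
    sum_pos (fun v _ => degree_pos_real hG v) ⟨x, mem_univ x⟩
  -- Centring at the weighted mean serves both inequalities: Poincaré needs mean zero, Nash needs `f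
  -- x - c` and `f y - c` of opposite signs.
  set c := (∑ v, (G.degree v : ℝ) * f v) / ∑ v, (G.degree v : ℝ) with hc
  have hcx : c ≤ f x := by
    rw [hc, div_le_iff₀ hvol, mul_sum]
    exact sum_le_sum fun v _ => by
      rw [mul_comm]; exact mul_le_mul_of_nonneg_right (hx v) (Nat.cast_nonneg _)
  have hcy : f y ≤ c := by
    rw [hc, le_div_iff₀ hvol, mul_sum]
    exact sum_le_sum fun v _ => by
      rw [mul_comm]; exact mul_le_mul_of_nonneg_left (hy v) (Nat.cast_nonneg _)
  have hmean : ∑ v, (G.degree v : ℝ) * (f v - c) = 0 := by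
    simp only [mul_sub, sum_sub_distrib]
    rw [← sum_mul, hc, mul_div_cancel₀ _ hvol.ne', sub_self]
  have hP := hpoin _ hmean
  have hN := sub_pow_four_le_energy_mul_sum_sq hG (fun v => f v - c) (x := x) (y := y)
    (by linarith) (by linarith)
  rw [energy_sub_const] at hP hN
  have hE := energy_nonneg G f
  set E := energy G f
  have hdeg : (G.minDegree : ℝ) * ∑ v, (f v - c) ^ 2 ≤ ∑ v, (G.degree v : ℝ) * (f v - c) ^ 2 := by
    rw [mul_sum]
    refine sum_le_sum fun v _ => ?_
    have : (G.minDegree : ℝ) ≤ G.degree v := by exact_mod_cast G.minDegree_le_degree v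
    gcongr
  have hvar : (G.minDegree : ℝ) * ∑ v, (f v - c) ^ 2 ≤ t * E / 2 := by
    refine hdeg.trans ?_
    calc ∑ v, (G.degree v : ℝ) * (f v - c) ^ 2
        = t * ((1 - secondEigenvalue G) * ∑ v, (G.degree v : ℝ) * (f v - c) ^ 2) := by
          rw [← mul_assoc, htgap, one_mul]
      _ ≤ t * (E / 2) := by gcongr
      _ = t * E / 2 := by ring
  have hD : ((G.minDegree : ℝ) * (f x - f y) ^ 2) ^ 2 ≤ (10 * √(t + 1) * E) ^ 2 := by
    have hsq : √(t + 1) ^ 2 = t + 1 := Real.sq_sqrt (by linarith)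
    calc ((G.minDegree : ℝ) * (f x - f y) ^ 2) ^ 2
        = 200 * (G.minDegree * ((G.minDegree : ℝ) / 200 * (f x - c - (f y - c)) ^ 4)) := by ring
      _ ≤ 200 * (G.minDegree * (E * ∑ v, (f v - c) ^ 2)) := by gcongr
      _ = 200 * (E * (G.minDegree * ∑ v, (f v - c) ^ 2)) := by ring
      _ ≤ 200 * (E * (t * E / 2)) := by gcongr
      _ ≤ 100 * (t + 1) * E ^ 2 := by nlinarith [sq_nonneg E]
      _ = (10 * √(t + 1) * E) ^ 2 := by rw [mul_pow, mul_pow, hsq]; norm_num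
  have hD' := (abs_le_of_sq_le_sq' hD (by positivity)).2
  calc (f x - f y) ^ 2 = (G.minDegree * (f x - f y) ^ 2) / G.minDegree := by field_simp
    _ ≤ (10 * √(t + 1) * E) / G.minDegree := by gcongr
    _ = 10 / G.minDegree * √(t + 1) * E := by ring

/-- The expected hitting times of `x`, as the solution of the Poisson equation off `x`. -/
theorem exists_poisson_solution [Nontrivial V] (hG : G.Connected) (x : V) :
    ∃ H : V → ℝ, H x = 0 ∧ (∀ v, 0 ≤ H v) ∧
      (∀ v, v ≠ x → (transition G *ᵥ H) v + 1 = H v) ∧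
      energy G H = 2 * ∑ v, (G.degree v : ℝ) * H v := by
  -- Grounding at `x` adds `f x ^ 2` to the quadratic form, which removes the constants from the
  -- kernel.
  set M := G.lapMatrix ℝ + diagonal (Pi.single x (1 : ℝ)) with hM
  have hMf : ∀ f v, (M *ᵥ f) v = (G.lapMatrix ℝ *ᵥ f) v + if v = x then f x else 0 := by
    intro f v
    rw [hM, add_mulVec, Pi.add_apply, mulVec_diagonal]
    by_cases h : v = x
    · subst h; simp
    · simp [h]
  have hinj : Function.Injective M.mulVec := by
    rw [← Matrix.coe_mulVecLin]
    refine (injective_iff_map_eq_zero M.mulVecLin).2 fun f hf => ?_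
    rw [Matrix.mulVecLin_apply] at hf
    have h0 : f ⬝ᵥ (M *ᵥ f) = energy G f + f x ^ 2 := by
      rw [energy_eq_dotProduct, dotProduct, dotProduct]
      simp_rw [hMf, mul_add]
      rw [sum_add_distrib]
      simp [sq]
    rw [hf, dotProduct_zero] at h0
    have hE := energy_nonneg G f
    have hE0 : energy G f = 0 := by nlinarith [sq_nonneg (f x)]
    have hx0 : f x = 0 := by
      rw [hE0, zero_add] at h0
      exact pow_eq_zero_iff two_ne_zero |>.1 h0.symm
    ext v
    rw [eq_of_energy_eq_zero hG hE0 v x, hx0, Pi.zero_apply]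
  set vol := ∑ v, (G.degree v : ℝ) with hvol
  -- The value at `x` makes the right-hand side sum to zero. As Laplacian images also sum to zero,
  -- this forces `H x = 0`.
  obtain ⟨H, hH⟩ := (mulVec_surjective_iff_isUnit.2 (mulVec_injective_iff_isUnit.1 hinj))
    (fun v => 2 * (G.degree v : ℝ) - if v = x then 2 * vol else 0)
  have hH' : ∀ v, (G.lapMatrix ℝ *ᵥ H) v + (if v = x then H x else 0) =
      2 * (G.degree v : ℝ) - if v = x then 2 * vol else 0 := fun v => by
    rw [← hMf, ← congrFun hH v]
  have hsum : ∑ v, (G.lapMatrix ℝ *ᵥ H) v = 0 := by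
    have h1 : ∑ v, (G.lapMatrix ℝ *ᵥ H) v = (fun _ => (1 : ℝ)) ⬝ᵥ (G.lapMatrix ℝ *ᵥ H) := by
      simp [dotProduct]
    rw [h1, dotProduct_mulVec, ← mulVec_transpose, (G.isSymm_lapMatrix ℝ).eq]
    rw [SimpleGraph.lapMatrix_mulVec_const_eq_zero, zero_dotProduct]
  have hHx : H x = 0 := by
    have h := sum_congr rfl fun v (_ : v ∈ univ) => hH' v
    rw [sum_add_distrib, hsum, sum_sub_distrib, ← mul_sum] at h
    simpa [← hvol] using h
  have hoff : ∀ v, v ≠ x → (G.lapMatrix ℝ *ᵥ H) v = 2 * (G.degree v : ℝ) := fun v hv => by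
    simpa [hv] using hH' v
  refine ⟨H, hHx, ?_, ?_, ?_⟩
  -- Minimum principle: at a negative minimum off `x` the Laplacian would be nonpositive, yet it
  -- equals twice the degree.
  · obtain ⟨w, -, hw⟩ := exists_min_image univ H ⟨x, mem_univ x⟩
    by_contra! hneg
    obtain ⟨v, hv⟩ := hneg
    have hwneg : H w < 0 := (hw v (mem_univ v)).trans_lt hv
    have hwx : w ≠ x := fun h => by rw [h, hHx] at hwneg; exact hwneg.false
    have h1 := hoff w hwx
    rw [SimpleGraph.lapMatrix_mulVec_apply] at h1
    have h2 : (G.degree w : ℝ) * H w ≤ ∑ u ∈ G.neighborFinset w, H u := by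
      rw [← SimpleGraph.card_neighborFinset_eq_degree, ← nsmul_eq_mul]
      exact card_nsmul_le_sum _ _ _ fun u _ => hw u (mem_univ u)
    have := degree_pos_real hG w
    linarith
  · intro v hv
    have h1 := degree_mul_sub_transition_mulVec hG H v
    rw [hoff v hv] at h1
    have hd := degree_pos_real hG v
    have h2 : H v - (transition G *ᵥ H) v = 1 := by
      refine mul_left_cancel₀ hd.ne' ?_
      rw [h1]; ring
    linarith
  · rw [energy_eq_dotProduct, dotProduct, mul_sum]
    refine sum_congr rfl fun v _ => ?_
    by_cases hv : v = x
    · rw [hv, hHx]; simp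
    · rw [hoff v hv]; ring

/-- The Poisson solution is bounded by `4 |E|` times the resistance bound. -/
theorem exists_poisson_solution_le [Nontrivial V] (hG : G.Connected) (x : V) :
    ∃ H : V → ℝ, (∀ v, 0 ≤ H v) ∧ (∀ v, v ≠ x → (transition G *ᵥ H) v + 1 = H v) ∧
      ∀ v, H v ≤ 20 * avgDegree G / G.minDegree * Fintype.card V * √(relaxationTime G + 1) := by
  obtain ⟨H, hHx, hpos, hstep, hen⟩ := exists_poisson_solution hG x
  refine ⟨H, hpos, hstep, ?_⟩
  obtain ⟨w, -, hw⟩ := exists_max_image univ H ⟨x, mem_univ x⟩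
  have hmain := sub_sq_le_sqrt_relaxationTime_mul_energy hG H (x := w) (y := x)
    (fun v => hw v (mem_univ v)) (fun v => hHx ▸ hpos v)
  rw [hHx, sub_zero, hen] at hmain
  have hvol : avgDegree G * Fintype.card V = ∑ v, (G.degree v : ℝ) := by
    rw [avgDegree, div_mul_cancel₀]
    exact_mod_cast Fintype.card_ne_zero
  have hsum : ∑ v, (G.degree v : ℝ) * H v ≤ (∑ v, (G.degree v : ℝ)) * H w := by
    rw [sum_mul]
    exact sum_le_sum fun v _ => mul_le_mul_of_nonneg_left (hw v (mem_univ v)) (Nat.cast_nonneg _)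
  set R := 10 / (G.minDegree : ℝ) * √(relaxationTime G + 1) with hR
  have hR0 : 0 ≤ R := by positivity
  have hbound : 20 * avgDegree G / G.minDegree * Fintype.card V * √(relaxationTime G + 1) =
      R * (2 * ∑ v, (G.degree v : ℝ)) := by
    rw [← hvol, hR]; ring
  intro v
  rw [hbound]
  refine (hw v (mem_univ v)).trans ?_
  rcases (hpos w).eq_or_lt with h0 | h0
  · rw [← h0]; positivity
  · refine le_of_mul_le_mul_right ?_ h0
    calc H w * H w = H w ^ 2 := (sq _).symm
      _ ≤ R * (2 * ∑ v, (G.degree v : ℝ) * H v) := hmain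
      _ ≤ R * (2 * ((∑ v, (G.degree v : ℝ)) * H w)) := by gcongr
      _ = R * (2 * ∑ v, (G.degree v : ℝ)) * H w := by ring

end Spectral


/-! ### Hitting times of the walk on trajectory space. -/

section Hitting

variable {V : Type*} [Fintype V] [DecidableEq V] {G : SimpleGraph V} [DecidableRel G.Adj]
variable [MeasurableSpace V] [DiscreteMeasurableSpace V] [Nontrivial V]

theorem lintegral_stepKernel (hG : G.Connected) (x : V) (K : V → ℝ≥0∞) :
    ∫⁻ z, K z ∂(stepKernel hG x) = ∑ z, ENNReal.ofReal (transition G x z) * K z := by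
  have h : stepKernel hG x = (stepPMF hG x).toMeasure := rfl
  rw [h, lintegral_fintype]
  refine sum_congr rfl fun z _ => ?_
  rw [PMF.toMeasure_apply_singleton _ _ (measurableSet_singleton z), mul_comm]
  rfl

/-- The Markov property at time `t`. -/
theorem lintegral_walkMeasure_succ (hG : G.Connected) (y : V) (t : ℕ)
    (F : (Finset.Iic t → V) → ℝ≥0∞) (K : V → ℝ≥0∞) :
    ∫⁻ ω, F (Preorder.frestrictLe t ω) * K (ω (t + 1)) ∂(walkMeasure hG y) =
      ∫⁻ ω, F (Preorder.frestrictLe t ω) *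
        ∑ z, ENNReal.ofReal (transition G (ω t) z) * K z ∂(walkMeasure hG y) := by
  have hF : Measurable F := Measurable.of_discrete
  have hK : Measurable K := Measurable.of_discrete
  have hFK : Measurable fun p : (Finset.Iic t → V) × V => F p.1 * K p.2 := by fun_prop
  have hmk := Kernel.map_frestrictLe_trajMeasure_compProd_eq_map_trajMeasure
    (X := fun _ => V) (μ₀ := Measure.dirac y) (κ := fun n =>
      (stepKernel hG).comap (fun h : (Finset.Iic n → V) => h ⟨n, Finset.mem_Iic.2 le_rfl⟩)
      (measurable_pi_apply _)) (a := t)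
  have h1 : ∫⁻ ω, F (Preorder.frestrictLe t ω) * K (ω (t + 1)) ∂(walkMeasure hG y) =
      ∫⁻ p, F p.1 * K p.2 ∂((walkMeasure hG y).map
        (fun ω => (Preorder.frestrictLe (π := fun _ => V) t ω, ω (t + 1)))) := by
    rw [lintegral_map hFK (by fun_prop)]
  rw [h1]
  unfold walkMeasure
  rw [← hmk, Measure.lintegral_compProd hFK, lintegral_map Measurable.of_discrete (by fun_prop)]
  refine lintegral_congr fun ω => ?_
  dsimp only
  rw [lintegral_const_mul _ hK, Kernel.comap_apply, lintegral_stepKernel]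
  rfl

theorem walkMeasure_map_zero (hG : G.Connected) (y : V) :
    (walkMeasure hG y).map (fun ω => ω 0) = Measure.dirac y := by
  have h0 : (fun ω : ℕ → V => ω 0) =
      (fun h : (Finset.Iic 0 → V) => h ⟨0, Finset.mem_Iic.2 le_rfl⟩) ∘
        Preorder.frestrictLe (π := fun _ => V) 0 := rfl
  rw [h0, ← Measure.map_map (by fun_prop) (by fun_prop)]
  unfold walkMeasure Kernel.trajMeasure
  rw [Measure.map_comp _ _ (by fun_prop), Kernel.traj_map_frestrictLe, Kernel.partialTraj_self,
    Measure.id_comp, Measure.map_map (by fun_prop) (by fun_prop)]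
  exact Measure.map_id

theorem lintegral_walkMeasure_zero (hG : G.Connected) (y : V) (K : V → ℝ≥0∞) :
    ∫⁻ ω, K (ω 0) ∂(walkMeasure hG y) = K y := by
  have hK : Measurable K := Measurable.of_discrete
  rw [← lintegral_map (f := K) (g := fun ω : ℕ → V => ω 0) hK (by fun_prop),
    walkMeasure_map_zero, lintegral_dirac' _ hK]

/-- The indicator that a path of length `t` avoids `x`. -/
noncomputable def avoids (x : V) (t : ℕ) (h : Finset.Iic t → V) : ℝ≥0∞ :=
  open scoped Classical in if ∀ i, h i ≠ x then 1 else 0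

omit [Fintype V] [MeasurableSpace V] [DiscreteMeasurableSpace V] [Nontrivial V] in
theorem avoids_succ_le (x : V) (t : ℕ) (ω : ℕ → V) :
    avoids x (t + 1) (Preorder.frestrictLe (π := fun _ => V) (t + 1) ω) ≤
      avoids x t (Preorder.frestrictLe (π := fun _ => V) t ω) := by
  unfold avoids
  split_ifs with h1 h2 h2
  · exact le_rfl
  · refine absurd (fun i => ?_) h2
    exact h1 ⟨i, Finset.mem_Iic.2 ((Finset.mem_Iic.1 i.2).trans (Nat.le_succ t))⟩
  · exact zero_le
  · exact le_rfl

theorem natCast_le_tsum_ite (n : ℕ∞) :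
    (n : ℝ≥0∞) ≤ ∑' t : ℕ, if (t : ℕ∞) < n then 1 else 0 := by
  induction n using ENat.recTopCoe with
  | top => simp
  | coe k =>
    refine le_trans (le_of_eq ?_) (ENNReal.sum_le_tsum (Finset.range k))
    rw [sum_congr rfl fun t ht => if_pos (Nat.cast_lt.2 (mem_range.1 ht))]
    simp

omit [Fintype V] [MeasurableSpace V] [DiscreteMeasurableSpace V] [Nontrivial V] in
-- Each time `t` before the hit contributes one avoiding initial segment; a path that never hits
-- gives an infinite sum.
theorem hittingTime_le_tsum (x : V) (ω : ℕ → V) :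
    (hittingTime x ω : ℝ≥0∞) ≤
      ∑' t, avoids x t (Preorder.frestrictLe (π := fun _ => V) t ω) := by
  refine (natCast_le_tsum_ite _).trans (ENNReal.tsum_le_tsum fun t => ?_)
  split_ifs with h
  · have : ∀ i : Finset.Iic t, Preorder.frestrictLe (π := fun _ => V) t ω i ≠ x := by
      intro i hi
      have hi' : ω i ∈ ({x} : Set V) := hi
      have hle : hittingTime x ω ≤ ((i : ℕ) : ℕ∞) :=
        hittingAfter_le_of_mem (u := fun (t : ℕ) (ω : ℕ → V) => ω t) (Nat.zero_le _) hi'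
      have h2 : ((i : ℕ) : ℕ∞) ≤ (t : ℕ∞) := Nat.cast_le.2 (Finset.mem_Iic.1 i.2)
      exact (hle.trans h2).not_gt h
    rw [avoids, if_pos this]
  · exact zero_le

/-- A nonnegative solution of the Poisson equation off `x` bounds the expected hitting time. -/
theorem expectedHittingTime_le (hG : G.Connected) (x y : V) (H : V → ℝ) (hpos : ∀ v, 0 ≤ H v)
    (hstep : ∀ v, v ≠ x → (transition G).mulVec H v + 1 = H v) :
    expectedHittingTime hG y x ≤ ENNReal.ofReal (H y) := by
  set μ := walkMeasure hG y
  let q : ℕ → (ℕ → V) → ℝ≥0∞ := fun t ω =>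
    avoids x t (Preorder.frestrictLe (π := fun _ => V) t ω)
  have hq : ∀ t, Measurable (q t) := fun t =>
    (Measurable.of_discrete (f := avoids x t)).comp (by fun_prop)
  have hHm : ∀ t, Measurable fun ω : ℕ → V => ENNReal.ofReal (H (ω t)) := fun t =>
    (Measurable.of_discrete (f := fun v => ENNReal.ofReal (H v))).comp (measurable_pi_apply t)
  -- `Φ t` is the remaining potential of the walk killed at `x`. By the Poisson equation one step
  -- lowers it by at least the probability of having avoided `x` through time `t`; these losses
  -- telescope to at most `Φ 0`.
  let Φ : ℕ → ℝ≥0∞ := fun t => ∫⁻ ω, q t ω * ENNReal.ofReal (H (ω t)) ∂μ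
  have hone : ∀ t, ∫⁻ ω, q t ω ∂μ + Φ (t + 1) ≤ Φ t := by
    intro t
    have h1 : Φ (t + 1) ≤ ∫⁻ ω, q t ω * ENNReal.ofReal (H (ω (t + 1))) ∂μ :=
      lintegral_mono fun ω => by
        dsimp only
        gcongr
        exact avoids_succ_le x t ω
    rw [lintegral_walkMeasure_succ hG y t (avoids x t) (fun v => ENNReal.ofReal (H v))] at h1
    refine (add_le_add_right h1 _).trans (le_of_eq ?_)
    rw [← lintegral_add_left (hq t)]
    refine lintegral_congr fun ω => ?_
    simp only [q, avoids]
    split_ifs with h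
    · have hx : ω t ≠ x := h ⟨t, Finset.mem_Iic.2 le_rfl⟩
      rw [one_mul, one_mul, ← hstep _ hx, ENNReal.ofReal_add _ zero_le_one, ENNReal.ofReal_one,
        add_comm, Matrix.mulVec, dotProduct, ENNReal.ofReal_sum_of_nonneg]
      · congr 1
        exact sum_congr rfl fun z _ => (ENNReal.ofReal_mul (transition_nonneg G _ _)).symm
      · exact fun z _ => mul_nonneg (transition_nonneg G _ _) (hpos z)
      · exact sum_nonneg fun z _ => mul_nonneg (transition_nonneg G _ _) (hpos z)
    · simp
  have hsum : ∀ T, ∑ t ∈ range T, ∫⁻ ω, q t ω ∂μ + Φ T ≤ Φ 0 := by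
    intro T
    induction T with
    | zero => simp
    | succ T ih =>
      rw [sum_range_succ, add_assoc]
      exact (add_le_add_right (hone T) _).trans ih
  have hΦ0 : Φ 0 ≤ ENNReal.ofReal (H y) := by
    rw [← lintegral_walkMeasure_zero hG y fun v => ENNReal.ofReal (H v)]
    refine lintegral_mono fun ω => ?_
    refine mul_le_of_le_one_left zero_le ?_
    simp only [q, avoids]
    split_ifs <;> simp
  calc expectedHittingTime hG y x ≤ ∫⁻ ω, ∑' t, q t ω ∂μ :=
        lintegral_mono fun ω => hittingTime_le_tsum x ω
    _ = ∑' t, ∫⁻ ω, q t ω ∂μ := lintegral_tsum fun t => (hq t).aemeasurable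
    _ ≤ ENNReal.ofReal (H y) := by
        rw [ENNReal.tsum_eq_iSup_nat]
        exact iSup_le fun T => (le_self_add.trans (hsum T)).trans hΦ0

end Hitting

end LazyWalk

theorem mainTheorem3 {V : Type*} [Fintype V] [DecidableEq V] [Nontrivial V]
    [MeasurableSpace V] [DiscreteMeasurableSpace V]
    (G : SimpleGraph V) [DecidableRel G.Adj] (hG : G.Connected) :
    LazyWalk.maxHittingTime hG ≤
      ENNReal.ofReal (20 * LazyWalk.avgDegree G / (G.minDegree : ℝ) * (Fintype.card V : ℝ) *
        Real.sqrt (LazyWalk.relaxationTime G + 1)) := by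
  refine iSup_le fun y => iSup_le fun x => ?_
  obtain ⟨H, hpos, hstep, hbound⟩ := LazyWalk.exists_poisson_solution_le hG x
  exact (LazyWalk.expectedHittingTime_le hG x y H hpos hstep).trans
    (ENNReal.ofReal_le_ofReal (hbound y))
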